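/- Let $N$ oscillators be coupled through constant gains $K_{ij}=K_{ji}$ with $K_{ij}\ge 0$, and let the network graph (vertices $1,\dots,N$, with $i\ne j$ adjacent iff $K_{ij}>0$) be connected. Put $e=\binom N2$, let $B\in\mathbb R^{N\times e}$ be the incidence matrix of the complete graph with edge $\{i,j\}$, $i<j$, oriented from $i$ to $j$ (entry $1$ at the vertex $i$ and $-1$ at the vertex $j$), let $\tilde K=(K_{ij})_{i<j}\in\mathbb R^e$, $K=\frac1N\operatorname{diag}(\tilde K)$, and let $\sin X$, $\cos X$ act componentwise. Consider on $\mathbb R^e\times\mathbb R^e$ the system $$X'=V,\qquad V'=G(X)V,\qquad G(X)=-B^\top BK\operatorname{diag}(\cos X).$$ Let $P=(-\tfrac\pi2,\tfrac\pi2)^e\cap\operatorname{Col}(B^\top)$ and $\mathcal E_s=\{(X,0):X\in P\}$, a set of equilibria. For $X\in P$ let $\mathcal J_X$ be the set of all $V=B^\top\omega-B^\top BK\sin X$ with $\omega\in\mathbb R^N$ such that $$|e_i^\top B^\top\omega|\le\tfrac2N\tilde K_i+\tfrac1N\sum_{j\ne i}|(B^\top B)_{ij}|\,\tilde K_j\sin|x_j|,\qquad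 i=1,\dots,e,$$ and let $\mathcal J=\bigcup_{X\in P}\mathcal J_X$, $\mathcal H=\{(X,V):X\in P,\ V\in\mathcal J\}$. For a set $S$, a point $x\in S$ with zero vector field is a Lyapunov stable equilibrium relative to $S$ if for every neighbourhood $U$ of $x$ there is a neighbourhood $W$ of $x$ such that every trajectory starting in $W\cap S$ stays in $U$ for all $t\ge 0$. It is semistable relative to $S$ if there is a neighbourhood $W$ of $x$ such that every trajectory starting in $W\cap S$ converges, as $t\to\infty$, to a Lyapunov stable equilibrium relative to $S$. Then every initial point has a unique solution on $[0,\infty)$, and every equilibrium in $\mathcal E_s$ (in particular it lies in $\mathcal H$) is semistable relative to $\mathcal H$. The same holds relative to the subset $\{(X,V):X\in P,\ V\in\mathcal J_X\}$ of $\mathcal H$, in which $V$ belongs to the same $X$. -/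

import Mathlib

open Topology Filter

noncomputable section

/-! ### Semistability relative to a set -/

/-- `γ` solves `γ' = f γ` on `[0, ∞)` (one-sided derivative at `0`). -/
def IsSolution {E : Type*} [NormedAddCommGroup E] [NormedSpace ℝ E] (f : E → E) (γ : ℝ → E) :
    Prop :=
  ∀ t : ℝ, 0 ≤ t → HasDerivWithinAt γ (f (γ t)) (Set.Ici 0) t

/-- `ψ` is the (forward) flow of `x' = f x`: for every initial point `z`, the curve `ψ(·, z)` is a
solution on `[0, ∞)` starting at `z`, and it is the only one. -/
structure IsSemiflow {E : Type*} [NormedAddCommGroup E] [NormedSpace ℝ E] (f : E → E)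
    (ψ : ℝ → E → E) : Prop where
  initial : ∀ z, ψ 0 z = z
  solution : ∀ z, IsSolution f (fun t => ψ t z)
  unique : ∀ γ : ℝ → E, IsSolution f γ → ∀ t : ℝ, 0 ≤ t → γ t = ψ t (γ 0)

/-- `x ∈ S` is a Lyapunov stable equilibrium relative to `S`: trajectories that start in `S` close
to `x` stay close to `x` for all `t ≥ 0`. -/
def IsLyapunovStableRel {E : Type*} [NormedAddCommGroup E] [NormedSpace ℝ E] (f : E → E)
    (ψ : ℝ → E → E) (S : Set E) (x : E) : Prop :=
  x ∈ S ∧ f x = 0 ∧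
    ∀ U ∈ 𝓝 x, ∃ W ∈ 𝓝 x, ∀ z ∈ W ∩ S, ∀ t : ℝ, 0 ≤ t → ψ t z ∈ U

/-- `x ∈ S` is a semistable equilibrium relative to `S`: each trajectory that starts in `S` close
to `x` converges, and its limit is a Lyapunov stable equilibrium relative to `S`. -/
def IsSemistableRel {E : Type*} [NormedAddCommGroup E] [NormedSpace ℝ E] (f : E → E)
    (ψ : ℝ → E → E) (S : Set E) (x : E) : Prop :=
  x ∈ S ∧ f x = 0 ∧
    ∃ W ∈ 𝓝 x, ∀ z ∈ W ∩ S, ∃ y : E,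
      Tendsto (fun t => ψ t z) atTop (𝓝 y) ∧ IsLyapunovStableRel f ψ S y

/-! ### The Kuramoto network -/

namespace Kuramoto

open Matrix

/-- The `N.choose 2` edges of the complete graph on the oscillators, the edge `{i, j}` with `i < j`
being oriented from `i` to `j`. -/
abbrev Edge (N : ℕ) : Type := {p : Fin N × Fin N // p.1 < p.2}

/-- Vectors of `ℝ^e`, `e = N.choose 2`. -/
abbrev EdgeVec (N : ℕ) : Type := Edge N → ℝ

/-- The incidence matrix of the oriented complete graph: `1` where the edge leaves the vertex,
`-1` where it enters the vertex. -/
def incidence (N : ℕ) : Matrix (Fin N) (Edge N) ℝ :=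
  Matrix.of fun i p => if i = p.1.1 then 1 else if i = p.1.2 then -1 else 0

/-- The vector of the coupling gains `K_ij`, `i < j`. -/
def gain {N : ℕ} (K : Fin N → Fin N → ℝ) : EdgeVec N := fun p => K p.1.1 p.1.2

/-- The coupling strength matrix `(1 / N) diag (gain K)`. -/
def couplingMatrix {N : ℕ} (K : Fin N → Fin N → ℝ) : Matrix (Edge N) (Edge N) ℝ :=
  (1 / (N : ℝ)) • Matrix.diagonal (gain K)

/-- The network graph: distinct oscillators are joined when their coupling gain is positive. -/
def networkGraph {N : ℕ} (K : Fin N → Fin N → ℝ) : SimpleGraph (Fin N) :=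
  SimpleGraph.fromRel fun i j => 0 < K i j

/-- `G(X) = - Bᵀ B K diag (cos X)`. -/
def matG {N : ℕ} (K : Fin N → Fin N → ℝ) (X : EdgeVec N) : Matrix (Edge N) (Edge N) ℝ :=
  -((incidence N)ᵀ * incidence N * couplingMatrix K *
    Matrix.diagonal fun p => Real.cos (X p))

/-- The vector field `F(X, V) = (V, G(X) V)`. -/
def field {N : ℕ} (K : Fin N → Fin N → ℝ) (z : EdgeVec N × EdgeVec N) :
    EdgeVec N × EdgeVec N :=
  (z.2, matG K z.1 *ᵥ z.2)

/-- The column space of `Bᵀ`. -/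
def colSpace (N : ℕ) : Submodule ℝ (EdgeVec N) := LinearMap.range (incidence N)ᵀ.mulVecLin

/-- `(-π/2, π/2)^e ∩ Col(Bᵀ)`. -/
def phaseBox (N : ℕ) : Set (EdgeVec N) :=
  {X | X ∈ colSpace N ∧ ∀ p, X p ∈ Set.Ioo (-(Real.pi / 2)) (Real.pi / 2)}

/-- The set `E_s` of the equilibria `(X, 0)` with `X ∈ (-π/2, π/2)^e ∩ Col(Bᵀ)`. -/
def stableEquilibria {N : ℕ} (K : Fin N → Fin N → ℝ) : Set (EdgeVec N × EdgeVec N) :=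
  {z | z.1 ∈ phaseBox N ∧ z.2 ∈ colSpace N ∧ field K z = 0}

/-- The velocities `Bᵀ ω - Bᵀ B K sin X` that belong to the phase differences `X`, for all those
natural frequencies `ω` whose differences satisfy the bound
`|e_pᵀ Bᵀ ω| ≤ (2 / N) K_p + (1 / N) ∑_{q ≠ p} |(Bᵀ B)_{pq}| K_q sin |X_q|`. -/
def velocities {N : ℕ} (K : Fin N → Fin N → ℝ) (X : EdgeVec N) : Set (EdgeVec N) :=
  {V | ∃ ω : Fin N → ℝ,
    V = (incidence N)ᵀ *ᵥ ω -
      ((incidence N)ᵀ * incidence N * couplingMatrix K) *ᵥ (fun p => Real.sin (X p)) ∧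
    ∀ p, |((incidence N)ᵀ *ᵥ ω) p| ≤
      2 / (N : ℝ) * gain K p +
        1 / (N : ℝ) * ∑ q ∈ Finset.univ.erase p,
          |((incidence N)ᵀ * incidence N) p q| * gain K q * Real.sin |X q|}

/-- The set `J` of the velocities that belong to some `X ∈ (-π/2, π/2)^e ∩ Col(Bᵀ)`. -/
def setJ {N : ℕ} (K : Fin N → Fin N → ℝ) : Set (EdgeVec N) :=
  {V | ∃ X ∈ phaseBox N, V ∈ velocities K X}

/-- The set `H` of the pairs `(X, V)` with `X ∈ (-π/2, π/2)^e ∩ Col(Bᵀ)` and `V ∈ J`. -/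
def setH {N : ℕ} (K : Fin N → Fin N → ℝ) : Set (EdgeVec N × EdgeVec N) :=
  {z | z.1 ∈ phaseBox N ∧ z.2 ∈ setJ K}

/-- The version of `H` in which the velocity `V` belongs to the same `X` as in the pair. -/
def setHFib {N : ℕ} (K : Fin N → Fin N → ℝ) : Set (EdgeVec N × EdgeVec N) :=
  {z | z.1 ∈ phaseBox N ∧ z.2 ∈ velocities K z.1}

end Kuramoto

end

/-! Since `G(X)` is minus the Jacobian of the interaction `Bᵀ B K sin X`, the sum of `V` and the
interaction is conserved. The system thus reduces to `X' = c - Bᵀ B K sin X`, a bounded Lipschitz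
equation, whence global existence and uniqueness.

On `Col(Bᵀ)`, which is invariant for both components, `Bᵀ B` acts as `N`. So `∑ V_p²` has derivative
`-2 ∑ K_p cos(X_p) V_p²`, and connectedness makes `∑ K_p V_p²` coercive there (`exists_coercive`).
While the cosines stay above some `m > 0`, `V` decays exponentially (`norm_snd_le_exp`), so `X`
travels only a short distance. A first-exit argument then keeps `X` near its start forever, and `X`
converges inside the box (`exists_forall_dist_lt_and_tendsto`). The limit is again an equilibrium of
the same kind, hence Lyapunov stable.

Of `H` and its variant only two facts matter: both components lie in `Col(Bᵀ)`, and all equilibria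
of the box belong to the set. -/

section GlobalFlow

/-! ### Global solutions of bounded Lipschitz equations -/

variable {E : Type*} [NormedAddCommGroup E] [NormedSpace ℝ E]

theorem IsSolution.continuousOn {f : E → E} {γ : ℝ → E} (h : IsSolution f γ) :
    ContinuousOn γ (Set.Ici 0) := fun t ht => (h t ht).continuousWithinAt

theorem IsSolution.hasDerivWithinAt_Ici {f : E → E} {γ : ℝ → E} (h : IsSolution f γ) {t : ℝ}
    (ht : 0 ≤ t) : HasDerivWithinAt γ (f (γ t)) (Set.Ici t) t :=
  (h t ht).mono (Set.Ici_subset_Ici.2 ht)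

/-- Solutions of a Lipschitz equation on `[0, ∞)` are determined by their initial point. -/
theorem IsSolution.eq_of_lipschitzWith {f : E → E} {L : NNReal} (hf : LipschitzWith L f)
    {γ η : ℝ → E} (hγ : IsSolution f γ) (hη : IsSolution f η) (h0 : γ 0 = η 0) {t : ℝ}
    (ht : 0 ≤ t) : γ t = η t :=
  ODE_solution_unique_of_mem_Icc_right (v := fun _ => f) (s := fun _ => Set.univ) (a := 0) (b := t)
    (fun _ _ => hf.lipschitzOnWith)
    (hγ.continuousOn.mono Set.Icc_subset_Ici_self) (fun _ hs => hγ.hasDerivWithinAt_Ici hs.1)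
    (fun _ _ => Set.mem_univ _)
    (hη.continuousOn.mono Set.Icc_subset_Ici_self) (fun _ hs => hη.hasDerivWithinAt_Ici hs.1)
    (fun _ _ => Set.mem_univ _) h0 ⟨ht, le_rfl⟩

/-- A bounded Lipschitz vector field has a solution on `[0, b]` for every `b`. -/
theorem exists_hasDerivWithinAt_Icc_of_bounded [CompleteSpace E] {f : E → E} {L M : NNReal}
    (hf : LipschitzWith L f) (hM : ∀ x, ‖f x‖ ≤ M) (x₀ : E) {b : ℝ} (hb : 0 ≤ b) :
    ∃ α : ℝ → E, α 0 = x₀ ∧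
      ∀ t ∈ Set.Icc 0 b, HasDerivWithinAt α (f (α t)) (Set.Icc 0 b) t := by
  -- The bound `M` holds everywhere, so the ball may have radius `M * b` and `b` is unrestricted.
  have h : IsPicardLindelof (fun _ => f) (tmin := 0) (tmax := b) ⟨0, le_rfl, hb⟩ x₀
      (M * ⟨b, hb⟩) 0 M L :=
    IsPicardLindelof.of_time_independent (fun x _ => hM x) hf.lipschitzOnWith
      (by simp only [sub_zero, sub_self, max_eq_left hb, NNReal.coe_zero]; exact le_rfl)
  exact h.exists_eq_forall_mem_Icc_hasDerivWithinAt₀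

/-- A bounded Lipschitz vector field has a solution on `[0, ∞)` through every point. -/
theorem exists_isSolution_of_bounded [CompleteSpace E] {f : E → E} {L M : NNReal}
    (hf : LipschitzWith L f) (hM : ∀ x, ‖f x‖ ≤ M) (x₀ : E) :
    ∃ γ : ℝ → E, γ 0 = x₀ ∧ IsSolution f γ := by
  choose α hα0 hα using fun n : ℕ =>
    exists_hasDerivWithinAt_Icc_of_bounded hf hM x₀ (Nat.cast_nonneg (α := ℝ) n)
  have hright : ∀ n : ℕ, ∀ t ∈ Set.Ico (0 : ℝ) n,
      HasDerivWithinAt (α n) (f (α n t)) (Set.Ici t) t := fun n t ht =>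
    (hα n t ⟨ht.1, ht.2.le⟩).mono_of_mem_nhdsWithin (Icc_mem_nhdsGE_of_mem ht)
  have hagree : ∀ m n : ℕ, m ≤ n → ∀ t ∈ Set.Icc (0 : ℝ) m, α m t = α n t := by
    intro m n hmn
    have hmn' : (m : ℝ) ≤ n := by exact_mod_cast hmn
    exact ODE_solution_unique_of_mem_Icc_right (v := fun _ => f) (s := fun _ => Set.univ)
      (fun _ _ => hf.lipschitzOnWith)
      (fun t ht => (hα m t ht).continuousWithinAt) (hright m) (fun _ _ => Set.mem_univ _)
      (fun t ht => ((hα n t ⟨ht.1, ht.2.trans hmn'⟩).continuousWithinAt).mono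
        (Set.Icc_subset_Icc_right hmn'))
      (fun t ht => hright n t ⟨ht.1, ht.2.trans_le hmn'⟩) (fun _ _ => Set.mem_univ _)
      ((hα0 m).trans (hα0 n).symm)
  have hglue : ∀ n : ℕ, ∀ t ∈ Set.Icc (0 : ℝ) n, α (⌊t⌋₊ + 1) t = α n t := by
    intro n t ht
    rcases le_total (⌊t⌋₊ + 1) n with h | h
    · exact hagree _ _ h t ⟨ht.1, by exact_mod_cast (Nat.lt_floor_add_one t).le⟩
    · exact (hagree _ _ h t ht).symm
  -- The `+ 1` puts `t` strictly before the right end of the interval, so the derivative there is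
  -- the one relative to `[0, ∞)`.
  refine ⟨fun t => α (⌊t⌋₊ + 1) t, by simp [hα0], fun t ht => ?_⟩
  have hlt : t < ((⌊t⌋₊ + 1 : ℕ) : ℝ) := by exact_mod_cast Nat.lt_floor_add_one t
  have hmem : Set.Icc (0 : ℝ) ((⌊t⌋₊ + 1 : ℕ) : ℝ) ∈ 𝓝[Set.Ici 0] t := by
    rw [← Set.Ici_inter_Iic]
    exact inter_mem self_mem_nhdsWithin (mem_nhdsWithin_of_mem_nhds (Iic_mem_nhds hlt))
  refine ((hα (⌊t⌋₊ + 1) t ⟨ht, hlt.le⟩).mono_of_mem_nhdsWithin hmem).congr_of_eventuallyEq ?_ rfl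
  filter_upwards [hmem] with s hs using hglue _ s hs

/-- A curve whose speed is at most `D e^{-l t}` moves by at most `(D / l) (e^{-l s} - e^{-l t})`
between the times `s` and `t`. -/
theorem norm_sub_le_of_exp_decay {γ γ' : ℝ → E} {D l s t : ℝ} (hl : 0 < l) (hst : s ≤ t)
    (hγ : ∀ u ∈ Set.Icc s t, HasDerivWithinAt γ (γ' u) (Set.Ici s) u)
    (hb : ∀ u ∈ Set.Icc s t, ‖γ' u‖ ≤ D * Real.exp (-(l * u))) :
    ‖γ t - γ s‖ ≤ D / l * (Real.exp (-(l * s)) - Real.exp (-(l * t))) := by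
  refine image_norm_le_of_norm_deriv_right_le_deriv_boundary (a := s) (b := t)
    (f := fun u => γ u - γ s) (f' := γ')
    (B := fun u => D / l * (Real.exp (-(l * s)) - Real.exp (-(l * u))))
    (B' := fun u => D * Real.exp (-(l * u))) ?_ ?_ (by simp) ?_
    (fun u hu => hb u ⟨hu.1, hu.2.le⟩) ⟨hst, le_rfl⟩
  · exact fun u hu => (((hγ u hu).continuousWithinAt).mono Set.Icc_subset_Ici_self).sub
      continuousWithinAt_const
  · exact fun u hu => ((hγ u ⟨hu.1, hu.2.le⟩).mono (Set.Ici_subset_Ici.2 hu.1)).sub_const _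
  · intro u
    have h : HasDerivAt (fun u : ℝ => -(l * u)) (-l) u := by
      simpa using! ((hasDerivAt_id u).const_mul l).neg
    refine ((h.exp.const_sub (Real.exp (-(l * s)))).const_mul (D / l)).congr_deriv ?_
    field_simp

end GlobalFlow

namespace Kuramoto

open Matrix

variable {N : ℕ}

/-! ### Algebra of the incidence matrix -/

theorem incidence_transpose_mulVec (θ : Fin N → ℝ) (p : Edge N) :
    ((incidence N)ᵀ *ᵥ θ) p = θ p.1.1 - θ p.1.2 := by
  have hne : p.1.2 ≠ p.1.1 := p.2.ne'
  have h : ∀ i, incidence N i p * θ i =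
      (if i = p.1.1 then θ i else 0) - (if i = p.1.2 then θ i else 0) := by
    intro i
    by_cases h1 : i = p.1.1
    · subst h1; simp [incidence, hne.symm]
    · by_cases h2 : i = p.1.2
      · subst h2; simp [incidence, hne]
      · simp [incidence, h1, h2]
  simp [mulVec, dotProduct, h, Finset.sum_sub_distrib]

theorem incidence_transpose_mul_self_diag (p : Edge N) :
    ((incidence N)ᵀ * incidence N) p p = 2 := by
  -- The entry is `Bᵀ` applied to the `p`-th column of `B`, read as a potential.
  have h := incidence_transpose_mulVec (fun i => incidence N i p) p
  have hne : p.1.2 ≠ p.1.1 := p.2.ne'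
  change ((incidence N)ᵀ *ᵥ fun i => incidence N i p) p = 2
  rw [h]
  simp [incidence, hne]
  norm_num

theorem sum_edge (F : Fin N × Fin N → ℝ) :
    ∑ p : Edge N, F p.1 = ∑ i, ∑ j, if i < j then F (i, j) else 0 := by
  rw [← Finset.sum_subtype (Finset.univ.filter fun q : Fin N × Fin N => q.1 < q.2) (by simp) F,
    Finset.sum_filter, Fintype.sum_prod_type]

/-- `B Bᵀ` is the Laplacian of the complete graph. -/
theorem incidence_mulVec_transpose_mulVec (θ : Fin N → ℝ) (i : Fin N) :
    (incidence N *ᵥ ((incidence N)ᵀ *ᵥ θ)) i = N * θ i - ∑ j, θ j := by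
  -- The vertex `i` is the tail or the head of an edge; either way the term is `θ i` minus the value
  -- at the other end.
  have h : ∀ a b : Fin N, (if a < b then
      (if i = a then 1 else if i = b then -1 else 0) * (θ a - θ b) else 0) =
      (if i = a then (if i < b then θ i - θ b else 0) else 0) +
        (if i = b then (if a < i then θ i - θ a else 0) else 0) := by
    intro a b
    by_cases hab : a < b
    · by_cases ha : i = a
      · subst ha; simp [hab, hab.ne]
      · by_cases hb : i = b
        · subst hb; simp [hab, ha]
        · simp [ha, hb]
    · by_cases ha : i = a
      · subst ha; simp [hab]
      · by_cases hb : i = b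
        · subst hb; simp [hab, ha]
        · simp [ha, hb]
  have h' : ∀ j, (if i < j then θ i - θ j else 0) + (if j < i then θ i - θ j else 0) =
      θ i - θ j := by
    intro j
    rcases lt_trichotomy i j with hij | rfl | hij
    · simp [hij, hij.not_gt]
    · simp
    · simp [hij, hij.not_gt]
  simp only [mulVec, dotProduct]
  have := sum_edge fun q : Fin N × Fin N =>
    (if i = q.1 then 1 else if i = q.2 then -1 else 0) * (θ q.1 - θ q.2)
  calc _ = _ := Finset.sum_congr rfl fun p _ => by
        rw [← incidence_transpose_mulVec]; rfl
    _ = _ := this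
    _ = _ := by
        simp only [h, Finset.sum_add_distrib]
        rw [Finset.sum_comm]
        simp only [Finset.sum_ite_eq, Finset.mem_univ, if_true]
        rw [← Finset.sum_add_distrib]
        simp only [h', Finset.sum_sub_distrib, Finset.sum_const, Finset.card_univ,
          Fintype.card_fin, nsmul_eq_mul]

/-- On the column space of `Bᵀ`, the matrix `Bᵀ B` acts as multiplication by `N`. -/
theorem incidence_transpose_mul_self_mulVec {V : EdgeVec N} (hV : V ∈ colSpace N) :
    ((incidence N)ᵀ * incidence N) *ᵥ V = (N : ℝ) • V := by
  obtain ⟨θ, rfl⟩ := hV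
  ext p
  rw [mulVecLin_apply, ← mulVec_mulVec, incidence_transpose_mulVec,
    incidence_mulVec_transpose_mulVec, incidence_mulVec_transpose_mulVec, Pi.smul_apply,
    incidence_transpose_mulVec, smul_eq_mul]
  ring

theorem incidence_transpose_mulVec_mem_colSpace (θ : Fin N → ℝ) :
    (incidence N)ᵀ *ᵥ θ ∈ colSpace N := ⟨θ, rfl⟩

theorem transpose_mul_mulVec_mem_colSpace {n : Type*} [Fintype n] (A : Matrix (Fin N) n ℝ)
    (u : n → ℝ) : ((incidence N)ᵀ * A) *ᵥ u ∈ colSpace N :=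
  ⟨A *ᵥ u, by rw [mulVecLin_apply, mulVec_mulVec]⟩

/-- Describes the column space by a linear equation, which can be propagated along solutions. -/
theorem mem_colSpace_of_smul_eq {X : EdgeVec N} (hN : N ≠ 0)
    (h : ((incidence N)ᵀ * incidence N) *ᵥ X = (N : ℝ) • X) : X ∈ colSpace N := by
  have hN' : (N : ℝ) ≠ 0 := Nat.cast_ne_zero.2 hN
  rw [← inv_smul_smul₀ hN' X, ← h]
  exact Submodule.smul_mem _ _ (transpose_mul_mulVec_mem_colSpace _ _)

/-! ### The interaction and its dissipation -/

/-- The interaction `Bᵀ B K sin X` of the oscillators. -/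
noncomputable def interaction (K : Fin N → Fin N → ℝ) (X : EdgeVec N) : EdgeVec N :=
  ((incidence N)ᵀ * incidence N * couplingMatrix K) *ᵥ fun p => Real.sin (X p)

theorem interaction_mem_colSpace (K : Fin N → Fin N → ℝ) (X : EdgeVec N) :
    interaction K X ∈ colSpace N := by
  rw [interaction, Matrix.mul_assoc]
  exact transpose_mul_mulVec_mem_colSpace _ _

theorem couplingMatrix_mulVec (K : Fin N → Fin N → ℝ) (u : EdgeVec N) (p : Edge N) :
    (couplingMatrix K *ᵥ u) p = 1 / (N : ℝ) * (gain K p * u p) := by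
  rw [couplingMatrix, smul_mulVec, Pi.smul_apply, mulVec_diagonal, smul_eq_mul]

theorem matG_mulVec (K : Fin N → Fin N → ℝ) (X V : EdgeVec N) :
    matG K X *ᵥ V = -(((incidence N)ᵀ * incidence N * couplingMatrix K) *ᵥ
      fun p => Real.cos (X p) * V p) := by
  rw [matG, neg_mulVec, ← mulVec_mulVec]
  congr 2
  ext p
  rw [mulVec_diagonal]

/-- On the column space of `Bᵀ` the velocities dissipate energy edge by edge. -/
theorem dotProduct_matG_mulVec (hN : N ≠ 0) (K : Fin N → Fin N → ℝ) (X : EdgeVec N)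
    {V : EdgeVec N} (hV : V ∈ colSpace N) :
    V ⬝ᵥ (matG K X *ᵥ V) = -∑ p, gain K p * Real.cos (X p) * V p ^ 2 := by
  have hN' : (N : ℝ) ≠ 0 := Nat.cast_ne_zero.2 hN
  have hsym : ((incidence N)ᵀ * incidence N)ᵀ = (incidence N)ᵀ * incidence N := by
    rw [transpose_mul, transpose_transpose]
  -- By symmetry `Bᵀ B` moves onto `V`, where it is the factor `N` that cancels the `1 / N` of the
  -- coupling matrix.
  rw [matG_mulVec, dotProduct_neg, ← mulVec_mulVec, dotProduct_mulVec, ← mulVec_transpose, hsym,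
    incidence_transpose_mul_self_mulVec hV]
  congr 1
  refine Finset.sum_congr rfl fun p _ => ?_
  rw [couplingMatrix_mulVec, Pi.smul_apply, smul_eq_mul]
  field_simp

/-! ### Coercivity from connectedness -/

theorem norm_le_sqrt_sum_sq {ι : Type*} [Fintype ι] (w : ι → ℝ) : ‖w‖ ≤ √(∑ p, w p ^ 2) := by
  refine (pi_norm_le_iff_of_nonneg (Real.sqrt_nonneg _)).2 fun p => ?_
  rw [Real.norm_eq_abs, ← Real.sqrt_sq_eq_abs]
  exact Real.sqrt_le_sqrt
    (Finset.single_le_sum (f := fun p => w p ^ 2) (fun q _ => sq_nonneg _) (Finset.mem_univ p))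

theorem sum_sq_le_card_mul_norm_sq {ι : Type*} [Fintype ι] (w : ι → ℝ) :
    ∑ p, w p ^ 2 ≤ Fintype.card ι * ‖w‖ ^ 2 := by
  have h : ∀ p ∈ Finset.univ, w p ^ 2 ≤ ‖w‖ ^ 2 := fun p _ => by
    rw [← sq_abs]
    exact pow_le_pow_left₀ (abs_nonneg _) (norm_le_pi_norm w p) 2
  simpa using Finset.sum_le_sum h

/-- A potential difference that vanishes along all edges of a connected network is zero. -/
theorem eq_zero_of_gain_mul_eq_zero {K : Fin N → Fin N → ℝ} (hsymm : ∀ i j, K i j = K j i)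
    (hconn : (networkGraph K).Connected) {Z : EdgeVec N} (hZ : Z ∈ colSpace N)
    (h : ∀ p, 0 < gain K p → Z p = 0) : Z = 0 := by
  obtain ⟨θ, rfl⟩ := hZ
  simp only [mulVecLin_apply, incidence_transpose_mulVec] at h
  have hadj : ∀ i j, (networkGraph K).Adj i j → θ i = θ j := by
    intro i j hij
    rw [networkGraph, SimpleGraph.fromRel_adj] at hij
    obtain ⟨hne, hpos⟩ := hij
    have hpos' : 0 < K i j := by
      rcases hpos with h | h
      · exact h
      · rwa [hsymm]
    rcases lt_or_gt_of_ne hne with hlt | hlt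
    · exact sub_eq_zero.1 (h ⟨(i, j), hlt⟩ hpos')
    · exact (sub_eq_zero.1 (h ⟨(j, i), hlt⟩ (by rwa [gain, hsymm]))).symm
  have hall : ∀ i j, θ i = θ j := by
    intro i j
    obtain ⟨w⟩ := hconn.preconnected i j
    induction w with
    | nil => rfl
    | cons hij _ ih => exact (hadj _ _ hij).trans ih
  ext p
  rw [mulVecLin_apply, incidence_transpose_mulVec, hall p.1.1 p.1.2, sub_self, Pi.zero_apply]

/-- The weighted energy of a connected network is coercive on the column space of `Bᵀ`. -/
theorem exists_coercive {K : Fin N → Fin N → ℝ} (hsymm : ∀ i j, K i j = K j i)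
    (hnonneg : ∀ i j, i < j → 0 ≤ K i j) (hconn : (networkGraph K).Connected) :
    ∃ μ : ℝ, 0 < μ ∧ ∀ Z ∈ colSpace N, μ * ∑ p, Z p ^ 2 ≤ ∑ p, gain K p * Z p ^ 2 := by
  have hg : ∀ p, 0 ≤ gain K p := fun p => hnonneg _ _ p.2
  -- The weighted energy is the squared Euclidean length of `T Z`; an injective linear map on a
  -- finite-dimensional space is bounded below.
  let T : colSpace N →ₗ[ℝ] EdgeVec N :=
    (Matrix.diagonal fun p => √(gain K p)).mulVecLin ∘ₗ (colSpace N).subtype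
  have hT : ∀ Z : colSpace N, ∀ p, T Z p = √(gain K p) * (Z : EdgeVec N) p := fun Z p => by
    simp [T, mulVec_diagonal]
  have hker : LinearMap.ker T = ⊥ := by
    refine (LinearMap.ker_eq_bot').2 fun Z hZ => Subtype.ext ?_
    refine eq_zero_of_gain_mul_eq_zero hsymm hconn Z.2 fun p hp => ?_
    have := hT Z p
    rw [hZ, Pi.zero_apply, eq_comm, mul_eq_zero] at this
    exact this.resolve_left (Real.sqrt_pos.2 hp).ne'
  obtain ⟨κ, hκ, hanti⟩ := T.exists_antilipschitzWith hker
  have hκ' : (0 : ℝ) < κ := hκ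
  set c : ℝ := (Fintype.card (Edge N) : ℝ)
  have hc : 0 ≤ c := Nat.cast_nonneg _
  -- `c + 1` rather than `c`, since there may be no edges.
  refine ⟨((c + 1) * κ ^ 2)⁻¹, by positivity, fun Z hZ => ?_⟩
  rw [inv_mul_le_iff₀ (by positivity)]
  have h1 : ‖Z‖ ≤ κ * ‖T ⟨Z, hZ⟩‖ := by
    simpa using hanti.le_mul_dist ⟨Z, hZ⟩ 0
  have h2 : ‖T ⟨Z, hZ⟩‖ ^ 2 ≤ ∑ p, gain K p * Z p ^ 2 := by
    have h3 := norm_le_sqrt_sum_sq (T ⟨Z, hZ⟩)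
    simp only [hT, mul_pow, Real.sq_sqrt (hg _)] at h3
    calc _ ≤ √(∑ p, gain K p * Z p ^ 2) ^ 2 := pow_le_pow_left₀ (norm_nonneg _) h3 2
      _ = _ := Real.sq_sqrt (Finset.sum_nonneg fun p _ => mul_nonneg (hg p) (sq_nonneg _))
  calc ∑ p, Z p ^ 2 ≤ c * ‖Z‖ ^ 2 := sum_sq_le_card_mul_norm_sq Z
    _ ≤ (c + 1) * (κ * ‖T ⟨Z, hZ⟩‖) ^ 2 := by gcongr; linarith
    _ = (c + 1) * κ ^ 2 * ‖T ⟨Z, hZ⟩‖ ^ 2 := by ring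
    _ ≤ _ := by gcongr

/-! ### Regularity of the interaction -/

theorem exists_lipschitzWith_interaction (K : Fin N → Fin N → ℝ) :
    ∃ L : NNReal, LipschitzWith L (interaction K) := by
  let A := LinearMap.toContinuousLinearMap
    ((incidence N)ᵀ * incidence N * couplingMatrix K).mulVecLin
  have hsin : LipschitzWith 1 fun (X : EdgeVec N) p => Real.sin (X p) := by
    refine LipschitzWith.of_dist_le_mul fun X Y => ?_
    rw [NNReal.coe_one, one_mul]
    refine (dist_pi_le_iff dist_nonneg).2 fun p => ?_
    have := Real.lipschitzWith_sin.dist_le_mul (X p) (Y p)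
    rw [NNReal.coe_one, one_mul] at this
    exact this.trans (dist_le_pi_dist X Y p)
  exact ⟨_, A.lipschitz.comp hsin⟩

theorem exists_norm_interaction_le (K : Fin N → Fin N → ℝ) :
    ∃ M : NNReal, ∀ X, ‖interaction K X‖ ≤ M := by
  let A := LinearMap.toContinuousLinearMap
    ((incidence N)ᵀ * incidence N * couplingMatrix K).mulVecLin
  refine ⟨‖A‖₊, fun X => ?_⟩
  have h : ‖fun p => Real.sin (X p)‖ ≤ 1 :=
    (pi_norm_le_iff_of_nonneg zero_le_one).2 fun p => Real.abs_sin_le_one _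
  exact (A.le_opNorm _).trans (mul_le_of_le_one_right (norm_nonneg _) h)

theorem hasDerivWithinAt_interaction (K : Fin N → Fin N → ℝ) {X : ℝ → EdgeVec N}
    {X' : EdgeVec N} {s : Set ℝ} {t : ℝ} (h : HasDerivWithinAt X X' s t) :
    HasDerivWithinAt (fun t => interaction K (X t)) (-(matG K (X t) *ᵥ X')) s t := by
  let A := LinearMap.toContinuousLinearMap
    ((incidence N)ᵀ * incidence N * couplingMatrix K).mulVecLin
  rw [matG_mulVec, neg_neg]
  have hsin : HasDerivWithinAt (fun t p => Real.sin (X t p)) (fun p => Real.cos (X t p) * X' p)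
      s t := hasDerivWithinAt_pi.2 fun p => (hasDerivWithinAt_pi.1 h p).sin
  exact A.hasFDerivAt.comp_hasDerivWithinAt t hsin

/-! ### Invariants of solutions and decay of the velocity -/

section Solution

variable {K : Fin N → Fin N → ℝ} {γ : ℝ → EdgeVec N × EdgeVec N}

theorem hasDerivWithinAt_fst (h : IsSolution (field K) γ) {t : ℝ} (ht : 0 ≤ t) :
    HasDerivWithinAt (fun t => (γ t).1) (γ t).2 (Set.Ici 0) t :=
  (ContinuousLinearMap.fst ℝ (EdgeVec N) (EdgeVec N)).hasFDerivAt.comp_hasDerivWithinAt t (h t ht)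

theorem hasDerivWithinAt_snd (h : IsSolution (field K) γ) {t : ℝ} (ht : 0 ≤ t) :
    HasDerivWithinAt (fun t => (γ t).2) (matG K (γ t).1 *ᵥ (γ t).2) (Set.Ici 0) t :=
  (ContinuousLinearMap.snd ℝ (EdgeVec N) (EdgeVec N)).hasFDerivAt.comp_hasDerivWithinAt t (h t ht)

/-- The differences of the natural frequencies are conserved. -/
theorem snd_add_interaction_eq (h : IsSolution (field K) γ) {t : ℝ} (ht : 0 ≤ t) :
    (γ t).2 + interaction K (γ t).1 = (γ 0).2 + interaction K (γ 0).1 := by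
  have hd : ∀ s, 0 ≤ s → HasDerivWithinAt (fun s => (γ s).2 + interaction K (γ s).1) 0
      (Set.Ici 0) s := fun s hs =>
    ((hasDerivWithinAt_snd h hs).add
      (hasDerivWithinAt_interaction K (hasDerivWithinAt_fst h hs))).congr_deriv (add_neg_cancel _)
  exact constant_of_has_deriv_right_zero (a := 0) (b := t)
    (f := fun s => (γ s).2 + interaction K (γ s).1)
    (fun s hs => ((hd s hs.1).continuousWithinAt).mono Set.Icc_subset_Ici_self)
    (fun s hs => (hd s hs.1).mono (Set.Ici_subset_Ici.2 hs.1)) t ⟨ht, le_rfl⟩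

/-- The conserved quantity becomes a parameter of a first-order equation that is bounded and
Lipschitz, which `field K` itself need not be. -/
theorem isSolution_fst (h : IsSolution (field K) γ) :
    IsSolution (fun X => (γ 0).2 + interaction K (γ 0).1 - interaction K X)
      fun t => (γ t).1 := fun t ht => by
  simpa [← snd_add_interaction_eq h ht] using hasDerivWithinAt_fst h ht

theorem isSolution_prodMk {c : EdgeVec N} {X : ℝ → EdgeVec N}
    (h : IsSolution (fun X => c - interaction K X) X) :
    IsSolution (field K) fun t => (X t, c - interaction K (X t)) := fun t ht => by
  have h1 := h t ht
  have h2 := (hasDerivWithinAt_interaction K h1).const_sub c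
  rw [neg_neg] at h2
  exact h1.prodMk h2

theorem snd_mem_colSpace (h : IsSolution (field K) γ) (h0 : (γ 0).2 ∈ colSpace N) {t : ℝ}
    (ht : 0 ≤ t) : (γ t).2 ∈ colSpace N := by
  rw [← Submodule.add_mem_iff_left _ (interaction_mem_colSpace K (γ t).1),
    snd_add_interaction_eq h ht]
  exact add_mem h0 (interaction_mem_colSpace _ _)

theorem fst_mem_colSpace (hN : N ≠ 0) (h : IsSolution (field K) γ) (h0 : (γ 0).1 ∈ colSpace N)
    (h0' : (γ 0).2 ∈ colSpace N) {t : ℝ} (ht : 0 ≤ t) : (γ t).1 ∈ colSpace N := by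
  -- `A = Bᵀ B - N` kills the column space, hence the velocity, so `A X` is constant.
  let A := LinearMap.toContinuousLinearMap
    (((incidence N)ᵀ * incidence N).mulVecLin - (N : ℝ) • LinearMap.id)
  have hA : ∀ Z ∈ colSpace N, A Z = 0 := fun Z hZ =>
    sub_eq_zero.2 (incidence_transpose_mul_self_mulVec hZ)
  have hd : ∀ s, 0 ≤ s → HasDerivWithinAt (fun s => A (γ s).1) 0 (Set.Ici 0) s := fun s hs =>
    (A.hasFDerivAt.comp_hasDerivWithinAt s (hasDerivWithinAt_fst h hs)).congr_deriv
      (hA _ (snd_mem_colSpace h h0' hs))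
  have hc : A (γ t).1 = A (γ 0).1 :=
    constant_of_has_deriv_right_zero (a := 0) (b := t) (f := fun s => A (γ s).1)
      (fun s hs => ((hd s hs.1).continuousWithinAt).mono Set.Icc_subset_Ici_self)
      (fun s hs => (hd s hs.1).mono (Set.Ici_subset_Ici.2 hs.1)) t ⟨ht, le_rfl⟩
  rw [hA _ h0] at hc
  exact mem_colSpace_of_smul_eq hN (sub_eq_zero.1 hc)

/-- As long as the cosines of the phase differences are at least `m`, the velocity decays. -/
theorem norm_snd_le_exp (hN : N ≠ 0) (hg : ∀ p, 0 ≤ gain K p) {μ m b : ℝ} (hm : 0 ≤ m)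
    (hμ : ∀ Z ∈ colSpace N, μ * ∑ p, Z p ^ 2 ≤ ∑ p, gain K p * Z p ^ 2)
    (h : IsSolution (field K) γ) (h0 : (γ 0).2 ∈ colSpace N)
    (hcos : ∀ t ∈ Set.Icc 0 b, ∀ p, m ≤ Real.cos ((γ t).1 p)) :
    ∀ t ∈ Set.Icc 0 b, ‖(γ t).2‖ ≤
      √(Fintype.card (Edge N)) * ‖(γ 0).2‖ * Real.exp (-(m * μ * t)) := by
  set l := m * μ
  set F : ℝ → ℝ := fun t => ∑ p, (γ t).2 p ^ 2
  have hF : ∀ t, 0 ≤ t → HasDerivWithinAt F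
      (-2 * ∑ p, gain K p * Real.cos ((γ t).1 p) * (γ t).2 p ^ 2) (Set.Ici 0) t := by
    intro t ht
    have h1 : HasDerivWithinAt F (∑ p, 2 * ((γ t).2 p * (matG K (γ t).1 *ᵥ (γ t).2) p))
        (Set.Ici 0) t := by
      refine HasDerivWithinAt.fun_sum fun p _ => ?_
      refine ((hasDerivWithinAt_pi.1 (hasDerivWithinAt_snd h ht) p).pow 2).congr_deriv ?_
      simp
      ring
    refine h1.congr_deriv ?_
    rw [← Finset.mul_sum]
    have := dotProduct_matG_mulVec hN K (γ t).1 (snd_mem_colSpace h h0 ht)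
    rw [dotProduct] at this
    rw [this]
    ring
  have hle : ∀ t ∈ Set.Icc 0 b,
      l * F t ≤ ∑ p, gain K p * Real.cos ((γ t).1 p) * (γ t).2 p ^ 2 := by
    intro t ht
    calc l * F t = m * (μ * F t) := by ring
      _ ≤ m * ∑ p, gain K p * (γ t).2 p ^ 2 :=
        mul_le_mul_of_nonneg_left (hμ _ (snd_mem_colSpace h h0 ht.1)) hm
      _ ≤ _ := by
        rw [Finset.mul_sum]
        refine Finset.sum_le_sum fun p _ => ?_
        rw [← mul_assoc, mul_comm m]
        exact mul_le_mul_of_nonneg_right (mul_le_mul_of_nonneg_left (hcos t ht p) (hg p))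
          (sq_nonneg _)
  have hexp : ∀ t, HasDerivAt (fun t => Real.exp (2 * l * t)) (Real.exp (2 * l * t) * (2 * l)) t :=
    fun t => by simpa using ((hasDerivAt_id t).const_mul (2 * l)).exp
  have hH : ∀ t, 0 ≤ t → HasDerivWithinAt (fun t => F t * Real.exp (2 * l * t)) _ (Set.Ici 0) t :=
    fun t ht => (hF t ht).mul (hexp t).hasDerivWithinAt
  -- Grönwall's inequality with integrating factor `e^{2 l t}`.
  have hanti : AntitoneOn (fun t => F t * Real.exp (2 * l * t)) (Set.Icc 0 b) := by
    refine antitoneOn_of_hasDerivWithinAt_nonpos (convex_Icc 0 b)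
      (fun t ht => ((hH t ht.1).continuousWithinAt).mono Set.Icc_subset_Ici_self)
      (fun t ht => (hH t (interior_subset ht).1).mono
        (interior_subset.trans Set.Icc_subset_Ici_self)) fun t ht => ?_
    have := mul_le_mul_of_nonneg_right (hle t (interior_subset ht)) (Real.exp_pos (2 * l * t)).le
    nlinarith [this]
  intro t ht
  -- The factor `√e`, with `e` the number of edges, is the cost of passing from the sup norm to the
  -- Euclidean one at time `0`.
  have hFt : F t ≤ (√(Fintype.card (Edge N)) * ‖(γ 0).2‖ * Real.exp (-(l * t))) ^ 2 := by
    have h1 : F t * Real.exp (2 * l * t) ≤ F 0 := by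
      simpa using hanti ⟨le_rfl, ht.1.trans ht.2⟩ ht ht.1
    have h2 : F 0 ≤ Fintype.card (Edge N) * ‖(γ 0).2‖ ^ 2 := sum_sq_le_card_mul_norm_sq _
    have h3 : Real.exp (-(l * t)) ^ 2 = (Real.exp (2 * l * t))⁻¹ := by
      rw [← Real.exp_neg, ← Real.exp_nat_mul]
      congr 1
      push_cast
      ring
    rw [mul_pow, mul_pow, Real.sq_sqrt (Nat.cast_nonneg _), h3, ← div_eq_mul_inv,
      le_div_iff₀ (Real.exp_pos _)]
    exact h1.trans h2
  exact (norm_le_sqrt_sum_sq _).trans (Real.sqrt_le_iff.2 ⟨by positivity, hFt⟩)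

end Solution

/-! ### Existence of the semiflow -/

theorem exists_isSemiflow (K : Fin N → Fin N → ℝ) : ∃ ψ, IsSemiflow (field K) ψ := by
  obtain ⟨L, hL⟩ := exists_lipschitzWith_interaction K
  obtain ⟨M, hM⟩ := exists_norm_interaction_le K
  have hLip : ∀ c, LipschitzWith L fun X => c - interaction K X := fun c => by
    simpa using! (LipschitzWith.const c).sub hL
  have hbd : ∀ c X, ‖c - interaction K X‖ ≤ (‖c‖₊ + M : NNReal) := fun c X =>
    (norm_sub_le _ _).trans (add_le_add le_rfl (hM X))
  choose Φ hΦ0 hΦ using fun z : EdgeVec N × EdgeVec N =>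
    exists_isSolution_of_bounded (hLip (z.2 + interaction K z.1)) (hbd _) z.1
  refine ⟨fun t z => (Φ z t, z.2 + interaction K z.1 - interaction K (Φ z t)),
    fun z => by simp [hΦ0], fun z => isSolution_prodMk (hΦ z), fun γ hγ t ht => ?_⟩
  -- Uniqueness for `X` in the reduced equation; the conservation law then determines `V`.
  have h1 := (isSolution_fst hγ).eq_of_lipschitzWith (hLip _) (hΦ (γ 0)) (hΦ0 _).symm ht
  refine Prod.ext h1 ?_
  simp only [← h1]
  exact eq_sub_of_add_eq (snd_add_interaction_eq hγ ht)

/-! ### Trapping and convergence near an equilibrium -/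

/-- Solutions that start near an equilibrium in the box stay close to it and converge to an
equilibrium in the box. -/
theorem exists_forall_dist_lt_and_tendsto {K : Fin N → Fin N → ℝ}
    (hsymm : ∀ i j, K i j = K j i) (hnonneg : ∀ i j, i < j → 0 ≤ K i j)
    (hconn : (networkGraph K).Connected) {x : EdgeVec N} (hx : x ∈ phaseBox N) {ε : ℝ}
    (hε : 0 < ε) :
    ∃ δ > 0, ∀ γ, IsSolution (field K) γ → (γ 0).1 ∈ colSpace N → (γ 0).2 ∈ colSpace N →
      dist (γ 0) (x, 0) < δ →
      (∀ t, 0 ≤ t → dist (γ t) (x, 0) < ε) ∧ ∃ y ∈ phaseBox N, Tendsto γ atTop (𝓝 (y, 0)) := by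
  have hN : N ≠ 0 := by
    have := hconn.nonempty
    exact (Fin.pos_iff_nonempty.2 this).ne'
  obtain ⟨μ, hμ, hcoer⟩ := exists_coercive hsymm hnonneg hconn
  obtain ⟨m, hm, hmx⟩ : ∃ m : ℝ, 0 < m ∧ ∀ p, m < Real.cos (x p) := by
    have h : ∀ᶠ m : ℝ in 𝓝[>] 0, ∀ p, m < Real.cos (x p) :=
      eventually_all.2 fun p => mem_nhdsWithin_of_mem_nhds
        (Iio_mem_nhds (Real.cos_pos_of_mem_Ioo (hx.2 p)))
    exact (eventually_mem_nhdsWithin.and h).exists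
  -- The ball is closed so that limits of trajectories in it still lie in the open box.
  obtain ⟨r, hr, hball⟩ : ∃ r > 0, ∀ X ∈ Metric.closedBall x r, ∀ p,
      m < Real.cos (X p) ∧ X p ∈ Set.Ioo (-(Real.pi / 2)) (Real.pi / 2) := by
    refine Metric.nhds_basis_closedBall.eventually_iff.1 (eventually_all.2 fun p => ?_)
    have hc : ContinuousAt (fun X : EdgeVec N => X p) x := (continuous_apply p).continuousAt
    exact ((Real.continuous_cos.continuousAt.comp hc).eventually (Ioi_mem_nhds (hmx p))).and
      (hc.eventually (isOpen_Ioo.mem_nhds (hx.2 p)))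
  set l := m * μ
  have hl : 0 < l := mul_pos hm hμ
  set C := √(Fintype.card (Edge N) : ℝ)
  have hC : 0 ≤ C := Real.sqrt_nonneg _
  set ρ := min r (ε / 2)
  have hρ : 0 < ρ := lt_min hr (half_pos hε)
  -- The three bounds on `δ` control the initial displacement (`ρ / 2`), the total drift `C ‖V(0)‖ /
  -- l` (`ρ / 2`) and the velocity (`ε`). `C + 1` avoids division by zero.
  refine ⟨min (ρ / 2) (min (l * (ρ / 2) / (C + 1)) (ε / (C + 1))), by positivity,
    fun γ hγ h01 h02 hd => ?_⟩
  rw [lt_min_iff, lt_min_iff, Prod.dist_eq, dist_zero_right] at hd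
  obtain ⟨hd1, hd2, hd3⟩ := hd
  have hX0 : dist (γ 0).1 x < ρ / 2 := (le_max_left _ _).trans_lt hd1
  have hV0 : C * ‖(γ 0).2‖ / l < ρ / 2 := by
    have := (lt_div_iff₀ (by positivity)).1 ((le_max_right _ _).trans_lt hd2)
    rw [div_lt_iff₀ hl]
    nlinarith [norm_nonneg (γ 0).2]
  have hV0' : C * ‖(γ 0).2‖ < ε := by
    have := (lt_div_iff₀ (by positivity)).1 ((le_max_right _ _).trans_lt hd3)
    nlinarith [norm_nonneg (γ 0).2]
  set D := C * ‖(γ 0).2‖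
  have hD : 0 ≤ D := by positivity
  have hdecay : ∀ b, (∀ t ∈ Set.Icc 0 b, dist (γ t).1 x ≤ ρ) →
      ∀ t ∈ Set.Icc 0 b, ‖(γ t).2‖ ≤ D * Real.exp (-(l * t)) := fun b hb =>
    norm_snd_le_exp hN (fun p => hnonneg _ _ p.2) hm.le hcoer hγ h02 fun t ht p =>
      (hball _ ((hb t ht).trans (min_le_left _ _)) p).1.le
  have hmove : ∀ b, (∀ t ∈ Set.Icc 0 b, dist (γ t).1 x ≤ ρ) → ∀ s, 0 ≤ s → s ≤ b →
      dist (γ s).1 (γ b).1 ≤ D / l * Real.exp (-(l * s)) := by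
    intro b hb s hs hsb
    rw [dist_comm, dist_eq_norm]
    refine (norm_sub_le_of_exp_decay (γ := fun t => (γ t).1) hl hsb
      (fun u hu => (hasDerivWithinAt_fst hγ (hs.trans hu.1)).mono (Set.Ici_subset_Ici.2 hs))
      fun u hu => hdecay b hb u ⟨hs.trans hu.1, hu.2⟩).trans ?_
    exact mul_le_mul_of_nonneg_left (sub_le_self _ (Real.exp_pos _).le) (by positivity)
  have hcont : ContinuousOn (fun t => dist (γ t).1 x) (Set.Ici 0) := fun t ht =>
    (hasDerivWithinAt_fst hγ ht).continuousWithinAt.dist continuousWithinAt_const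
  have hstay : ∀ t, 0 ≤ t → dist (γ t).1 x < ρ := by
    intro T hT
    by_contra! hTρ
    have hc : ContinuousOn (fun t => dist (γ t).1 x) (Set.Icc 0 T) :=
      hcont.mono Set.Icc_subset_Ici_self
    set B := {t ∈ Set.Icc 0 T | ρ ≤ dist (γ t).1 x}
    have hBc : IsCompact B := by
      have : IsClosed (Set.Icc 0 T ∩ (fun t => dist (γ t).1 x) ⁻¹' Set.Ici ρ) :=
        hc.preimage_isClosed_of_isClosed isClosed_Icc isClosed_Ici
      exact isCompact_Icc.of_isClosed_subset this fun t ht => ht.1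
    -- At the first time `b` of distance at least `ρ`, the decay estimate is valid on all of `[0,
    -- b]`; displacement plus drift is then below `ρ`, a contradiction.
    obtain ⟨b, hbB, hbmin⟩ := hBc.exists_isLeast ⟨T, ⟨hT, le_rfl⟩, hTρ⟩
    have hlt : ∀ t ∈ Set.Ico 0 b, dist (γ t).1 x < ρ := by
      intro t ht
      by_contra! h
      exact (hbmin ⟨⟨ht.1, ht.2.le.trans hbB.1.2⟩, h⟩).not_gt ht.2
    have hb0 : 0 < b := by
      refine hbB.1.1.lt_of_ne fun h => ?_
      have := hbB.2
      rw [← h] at this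
      linarith
    have hle : ∀ t ∈ Set.Icc 0 b, dist (γ t).1 x ≤ ρ := by
      have hcl : closure (Set.Ico 0 b) = Set.Icc 0 b := closure_Ico hb0.ne
      intro t ht
      refine ContinuousWithinAt.closure_le (f := fun t => dist (γ t).1 x) (g := fun _ => ρ)
        (s := Set.Ico 0 b) (by rwa [hcl])
        ((hcont t ht.1).mono fun s hs => hs.1) continuousWithinAt_const fun s hs => (hlt s hs).le
    have h1 := hmove b hle 0 le_rfl hb0.le
    rw [mul_zero, neg_zero, Real.exp_zero, mul_one, dist_comm] at h1
    linarith [dist_triangle (γ b).1 (γ 0).1 x, hbB.2]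
  have hstay' : ∀ b, ∀ t ∈ Set.Icc 0 b, dist (γ t).1 x ≤ ρ := fun b t ht => (hstay t ht.1).le
  have hvel : ∀ t, 0 ≤ t → ‖(γ t).2‖ ≤ D * Real.exp (-(l * t)) := fun t ht =>
    hdecay t (hstay' t) t ⟨ht, le_rfl⟩
  have hexp : Tendsto (fun t => Real.exp (-(l * t))) atTop (𝓝 0) :=
    Real.tendsto_exp_neg_atTop_nhds_zero.comp (tendsto_id.const_mul_atTop hl)
  have hmax : (fun t : ℝ => max t 0) =ᶠ[atTop] id := by
    filter_upwards [eventually_ge_atTop 0] with t ht using max_eq_left ht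
  refine ⟨fun t ht => ?_, ?_⟩
  · rw [Prod.dist_eq, dist_zero_right]
    refine max_lt ((hstay t ht).trans_le ((min_le_right _ _).trans (by linarith))) ?_
    refine (hvel t ht).trans_lt ((mul_le_of_le_one_right hD ?_).trans_lt hV0')
    exact Real.exp_le_one_iff.2 (neg_nonpos.2 (by positivity))
  -- Truncating time at `0` gives a curve on all of `ℝ` to which the estimates for `t ≥ 0` apply.
  · have hcau : CauchySeq fun t : ℝ => (γ (max t 0)).1 := by
      refine cauchySeq_of_le_tendsto_0' (fun t => D / l * Real.exp (-(l * t))) (fun s t hst => ?_)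
        (by simpa using hexp.const_mul (D / l))
      refine (hmove _ (hstay' _) _ (le_max_right _ _) (max_le_max_right 0 hst)).trans ?_
      refine mul_le_mul_of_nonneg_left (Real.exp_le_exp.2 (neg_le_neg ?_)) (by positivity)
      exact mul_le_mul_of_nonneg_left (le_max_left _ _) hl.le
    obtain ⟨y, hy⟩ := cauchySeq_tendsto_of_complete hcau
    have hyball : y ∈ Metric.closedBall x r :=
      Metric.isClosed_closedBall.mem_of_tendsto hy (.of_forall fun t =>
        (hstay _ (le_max_right _ _)).le.trans (min_le_left _ _))
    have hycol : y ∈ colSpace N :=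
      (Submodule.closed_of_finiteDimensional (colSpace N)).mem_of_tendsto hy (.of_forall fun t =>
        fst_mem_colSpace hN hγ h01 h02 (le_max_right _ _))
    refine ⟨y, ⟨hycol, fun p => (hball y hyball p).2⟩, Tendsto.prodMk_nhds (mx := fun t => (γ t).1)
      (my := fun t => (γ t).2) ?_ ?_⟩
    · exact hy.congr' (hmax.mono fun t ht => by simp only [ht, id])
    · refine squeeze_zero_norm' ?_ (by simpa using hexp.const_mul D)
      filter_upwards [eventually_ge_atTop 0] with t ht using hvel t ht

/-! ### The velocity sets and relative semistability -/

theorem velocities_subset_colSpace (K : Fin N → Fin N → ℝ) (X : EdgeVec N) :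
    velocities K X ⊆ colSpace N := by
  rintro V ⟨ω, rfl, -⟩
  exact sub_mem (incidence_transpose_mulVec_mem_colSpace ω) (interaction_mem_colSpace K X)

/-- The frequencies that balance the interaction at `X ∈ (-π/2, π/2)^e` satisfy the bound in the
definition of `velocities`. -/
theorem zero_mem_velocities {K : Fin N → Fin N → ℝ} (hg : ∀ p, 0 ≤ gain K p) {X : EdgeVec N}
    (hX : ∀ p, X p ∈ Set.Ioo (-(Real.pi / 2)) (Real.pi / 2)) : 0 ∈ velocities K X := by
  have habs : ∀ p, |Real.sin (X p)| = Real.sin |X p| := fun p =>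
    Real.abs_sin_eq_sin_abs_of_abs_le_pi
      ((abs_lt.2 (hX p)).le.trans (by linarith [Real.pi_pos]))
  have hmul : (incidence N)ᵀ *ᵥ ((incidence N * couplingMatrix K) *ᵥ fun p => Real.sin (X p)) =
      ((incidence N)ᵀ * incidence N * couplingMatrix K) *ᵥ fun p => Real.sin (X p) := by
    rw [mulVec_mulVec, Matrix.mul_assoc]
  refine ⟨(incidence N * couplingMatrix K) *ᵥ fun p => Real.sin (X p), ?_, fun p => ?_⟩
  · rw [hmul, sub_self]
  rw [hmul, ← mulVec_mulVec, mulVec, dotProduct,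
    ← Finset.add_sum_erase Finset.univ _ (Finset.mem_univ p)]
  have hN : (0 : ℝ) ≤ 1 / N := by positivity
  -- The diagonal entry `2` with `|sin| ≤ 1` gives the first term of the bound; off the diagonal the
  -- terms agree, as `|sin X_q| = sin |X_q|` in the box.
  refine (abs_add_le _ _).trans (add_le_add ?_ ?_)
  · rw [incidence_transpose_mul_self_diag, couplingMatrix_mulVec, abs_mul, abs_mul, abs_mul,
      abs_of_nonneg hN, abs_of_nonneg (hg p), abs_two]
    have h1 := mul_le_of_le_one_right (hg p) (Real.abs_sin_le_one (X p))
    calc 2 * (1 / (N : ℝ) * (gain K p * |Real.sin (X p)|)) ≤ 2 * (1 / (N : ℝ) * gain K p) := by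
          gcongr
      _ = _ := by ring
  · rw [Finset.mul_sum]
    refine (Finset.abs_sum_le_sum_abs _ _).trans (Finset.sum_le_sum fun q _ => le_of_eq ?_)
    rw [couplingMatrix_mulVec, abs_mul, abs_mul, abs_mul, abs_of_nonneg hN,
      abs_of_nonneg (hg q), habs]
    ring

/-- Equilibria in the box are semistable relative to every set of phase differences in the box and
velocities in the column space of `Bᵀ` that contains all these equilibria. -/
theorem isSemistableRel_of_subset {K : Fin N → Fin N → ℝ}
    (hsymm : ∀ i j, K i j = K j i) (hnonneg : ∀ i j, i < j → 0 ≤ K i j)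
    (hconn : (networkGraph K).Connected) {ψ : ℝ → EdgeVec N × EdgeVec N → EdgeVec N × EdgeVec N}
    (hψ : IsSemiflow (field K) ψ) {S : Set (EdgeVec N × EdgeVec N)}
    (hS : ∀ z ∈ S, z.1 ∈ colSpace N ∧ z.2 ∈ colSpace N) (hS' : ∀ x ∈ phaseBox N, (x, 0) ∈ S)
    {x : EdgeVec N} (hx : x ∈ phaseBox N) : IsSemistableRel (field K) ψ S (x, 0) := by
  have hzero : ∀ y : EdgeVec N, field K (y, 0) = 0 := fun y => by simp [field]
  have hstable : ∀ y ∈ phaseBox N, IsLyapunovStableRel (field K) ψ S (y, 0) := by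
    refine fun y hy => ⟨hS' y hy, hzero y, fun U hU => ?_⟩
    obtain ⟨ε, hε, hεU⟩ := Metric.mem_nhds_iff.1 hU
    obtain ⟨δ, hδ, h⟩ := exists_forall_dist_lt_and_tendsto hsymm hnonneg hconn hy hε
    refine ⟨Metric.ball (y, 0) δ, Metric.ball_mem_nhds _ hδ, fun z hz t ht => hεU ?_⟩
    exact (h (fun t => ψ t z) (hψ.solution z) (by simpa [hψ.initial] using (hS z hz.2).1)
      (by simpa [hψ.initial] using (hS z hz.2).2) (by simpa only [hψ.initial, Metric.mem_ball] using hz.1)).1 t ht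
  -- Only convergence is needed here, so the radius `1` is arbitrary.
  obtain ⟨δ, hδ, h⟩ := exists_forall_dist_lt_and_tendsto hsymm hnonneg hconn hx one_pos
  refine ⟨hS' x hx, hzero x, Metric.ball (x, 0) δ, Metric.ball_mem_nhds _ hδ, fun z hz => ?_⟩
  obtain ⟨y, hy, hlim⟩ := (h (fun t => ψ t z) (hψ.solution z)
    (by simpa [hψ.initial] using (hS z hz.2).1) (by simpa [hψ.initial] using (hS z hz.2).2)
    (by simpa only [hψ.initial, Metric.mem_ball] using hz.1)).2
  exact ⟨(y, 0), hlim, hstable y hy⟩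

end Kuramoto

theorem mainTheorem5 {N : ℕ} (K : Fin N → Fin N → ℝ)
    (hsymm : ∀ i j, K i j = K j i) (hnonneg : ∀ i j, i < j → 0 ≤ K i j)
    (hconn : (Kuramoto.networkGraph K).Connected) :
    ∃ ψ : ℝ → Kuramoto.EdgeVec N × Kuramoto.EdgeVec N →
        Kuramoto.EdgeVec N × Kuramoto.EdgeVec N,
      IsSemiflow (Kuramoto.field K) ψ ∧
      ∀ z ∈ Kuramoto.stableEquilibria K,
        IsSemistableRel (Kuramoto.field K) ψ (Kuramoto.setH K) z ∧
        IsSemistableRel (Kuramoto.field K) ψ (Kuramoto.setHFib K) z := by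
  obtain ⟨ψ, hψ⟩ := Kuramoto.exists_isSemiflow K
  refine ⟨ψ, hψ, ?_⟩
  have hvel : ∀ x ∈ Kuramoto.phaseBox N, (0 : Kuramoto.EdgeVec N) ∈ Kuramoto.velocities K x :=
    fun x hx => Kuramoto.zero_mem_velocities (fun p => hnonneg _ _ p.2) hx.2
  rintro ⟨x, v⟩ ⟨hx, -, hz⟩
  obtain rfl : v = 0 := congrArg Prod.fst hz
  refine ⟨Kuramoto.isSemistableRel_of_subset hsymm hnonneg hconn hψ ?_ ?_ hx,
    Kuramoto.isSemistableRel_of_subset hsymm hnonneg hconn hψ ?_ ?_ hx⟩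
  -- The velocity may belong to another point `Y` of the box; only its membership in the column
  -- space counts.
  · rintro z ⟨h1, Y, -, h2⟩
    exact ⟨h1.1, Kuramoto.velocities_subset_colSpace K Y h2⟩
  · exact fun y hy => ⟨hy, y, hy, hvel y hy⟩
  · exact fun z hz => ⟨hz.1.1, Kuramoto.velocities_subset_colSpace K _ hz.2⟩
  · exact fun y hy => ⟨hy, hvel y hy⟩
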